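/- A CNOT gate on $n$ bits with distinct control $c$ and target $t$ maps $x \in \mathbb F_2^n$ to the vector obtained by replacing $x_t$ with $x_t + x_c$. A Toffoli gate with distinct controls $a, b$ and target $t$ (three distinct positions) replaces $x_t$ with $x_t + x_a x_b$. For integers $n, k, e$, an $(n,k,e)$ purification circuit is a finite sequence of CNOT and Toffoli gates on $n$ bits for which there is a set $S$ of $k$ (nominated) positions such that the composition of the gates maps every $x \in \mathbb F_2^n$ of Hamming weight at most $e$ to a vector that vanishes in all the positions in $S$. Proposition. Let $n \geq 1$ and $k, e \in \{1, \ldots, n\}$. If $$\binom n 0 + \binom n 1 + \cdots + \binom n e \leq 2^{n-k},$$ then there is an $(n,k,e)$ purification circuit. -/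

import Mathlib

/-- Bitstrings of length `n`, viewed as vectors over the field with two elements. -/
abbrev Bitstring (n : ℕ) : Type := Fin n → ZMod 2

/-- The CNOT and Toffoli gates on `n` wires: each has a target and one, respectively two,
controls, and all the wires involved are distinct. -/
inductive Gate (n : ℕ) : Type
  | cnot (control target : Fin n) (h : control ≠ target) : Gate n
  | toffoli (control₁ control₂ target : Fin n) (h₁₂ : control₁ ≠ control₂)
      (h₁ : control₁ ≠ target) (h₂ : control₂ ≠ target) : Gate n

/-- The action of a gate on bitstrings: the target is flipped exactly when every control is `1`. -/
def Gate.apply {n : ℕ} : Gate n → Bitstring n → Bitstring n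
  | .cnot c t _, x => Function.update x t (x t + x c)
  | .toffoli a b t _ _ _, x => Function.update x t (x t + x a * x b)

/-- A CNOT and Toffoli circuit on `n` wires (no further wires are available): a finite sequence
of gates, the head of the list being applied first. -/
abbrev Circuit (n : ℕ) : Type := List (Gate n)

/-- The output of a circuit on an input bitstring. -/
def Circuit.run {n : ℕ} (C : Circuit n) (x : Bitstring n) : Bitstring n :=
  C.foldl (fun y g => g.apply y) x

/-- `C` is an `(n, k, e)` purification circuit: there are `k` nominated positions in which the
output is zero for every input of Hamming weight at most `e`. -/
def IsPurificationCircuit (n k e : ℕ) (C : Circuit n) : Prop :=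
  ∃ S : Finset (Fin n), S.card = k ∧
    ∀ x : Bitstring n, hammingNorm x ≤ e → ∀ i ∈ S, C.run x i = 0

/-! Gates are involutions fixing `0`, so circuits compute a group acting on the nonzero vectors.
CNOTs generate all of GL(n, 2), which is 2-transitive there, so the group is primitive. By Jordan's
theorems it contains the alternating group once it has a three-cycle (`exists_isThreeCycle`, `n ≥
4`) or a transposition (`exists_isSwap`, `n = 3`). The alternating group is transitive on subsets of
each size, so the vectors of weight at most `e` can be moved into the subspace vanishing on `S`,
which the bound makes large enough. -/

open Equiv Equiv.Perm MulAction

namespace Gate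

variable {n : ℕ}

theorem involutive_apply (g : Gate n) : Function.Involutive g.apply := by
  intro x
  cases g with
  | cnot c t h =>
    simp only [apply, Function.update_self, Function.update_idem, Function.update_of_ne h]
    rw [add_assoc, CharTwo.add_self_eq_zero, add_zero, Function.update_eq_self]
  | toffoli a b t h₁₂ h₁ h₂ =>
    simp only [apply, Function.update_self, Function.update_idem, Function.update_of_ne h₁,
      Function.update_of_ne h₂]
    rw [add_assoc, CharTwo.add_self_eq_zero, add_zero, Function.update_eq_self]

@[simp]
theorem apply_zero (g : Gate n) : g.apply 0 = 0 := by
  cases g <;> simp [apply]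

end Gate

/-! ### The group of circuits and its primitivity -/

namespace Circuit

variable {n : ℕ}

@[simp]
theorem run_nil (x : Bitstring n) : run ([] : Circuit n) x = x := rfl

@[simp]
theorem run_cons (g : Gate n) (C : Circuit n) (x : Bitstring n) :
    run (g :: C) x = run C (g.apply x) := rfl

theorem run_append (C D : Circuit n) (x : Bitstring n) : run (C ++ D) x = run D (run C x) :=
  List.foldl_append

theorem run_zero (C : Circuit n) : run C 0 = 0 := by
  induction C with
  | nil => rfl
  | cons g C ih => simpa using ih

theorem run_reverse_run (C : Circuit n) (x : Bitstring n) : run C.reverse (run C x) = x := by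
  induction C generalizing x with
  | nil => rfl
  | cons g C ih => simp [run_append, ih, g.involutive_apply x]

/-- The permutations of bitstrings computed by circuits. -/
def permSubgroup (n : ℕ) : Subgroup (Perm (Bitstring n)) where
  carrier := {σ | ∃ C : Circuit n, ∀ x, run C x = σ x}
  one_mem' := ⟨[], fun _ => rfl⟩
  mul_mem' := by
    rintro σ τ ⟨C, hC⟩ ⟨D, hD⟩
    exact ⟨D ++ C, fun x => by rw [run_append, hD, hC, Perm.mul_apply]⟩
  inv_mem' := by
    rintro σ ⟨C, hC⟩
    refine ⟨C.reverse, fun x => ?_⟩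
    have h := run_reverse_run C (σ⁻¹ x)
    rwa [hC, ← Perm.mul_apply, mul_inv_cancel, Perm.one_apply] at h

/-- The permutations of nonzero bitstrings computed by circuits. -/
def nonzeroPermSubgroup (n : ℕ) : Subgroup (Perm {x : Bitstring n // x ≠ 0}) :=
  (permSubgroup n).comap ofSubtype

theorem exists_ofSubtype_eq {σ : Perm (Bitstring n)} (hσ : σ ∈ permSubgroup n) :
    ∃ τ ∈ nonzeroPermSubgroup n, ofSubtype τ = σ := by
  obtain ⟨C, hC⟩ := hσ
  have h0 : σ 0 = 0 := by rw [← hC, run_zero]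
  have h := ofSubtype_subtypePerm (p := fun x : Bitstring n => x ≠ 0) (f := σ)
    (fun x => not_congr ⟨fun h => σ.injective (h.trans h0.symm), fun h => h ▸ h0⟩)
    (fun x hx h => hx (by rw [h, h0]))
  refine ⟨_, ?_, h⟩
  rw [nonzeroPermSubgroup, Subgroup.mem_comap, h]
  exact ⟨C, hC⟩

/-- Over `ZMod 2` the nontrivial transvections are exactly the CNOTs, and an invertible diagonal
matrix is `1`. -/
theorem exists_run_eq_mulVec (M : Matrix (Fin n) (Fin n) (ZMod 2)) (hM : M.det ≠ 0) :
    ∃ C : Circuit n, ∀ x, run C x = M.mulVec x := by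
  refine Matrix.diagonal_transvection_induction_of_det_ne_zero
    (fun M => ∃ C : Circuit n, ∀ x, run C x = M.mulVec x) M hM ?_ ?_ ?_
  · intro D hD
    have hone : D = 1 := by
      ext i
      rw [Matrix.det_diagonal, Finset.prod_ne_zero_iff] at hD
      exact Fin.eq_one_of_ne_zero (D i) (hD i (Finset.mem_univ i))
    exact ⟨[], fun x => by rw [hone, Matrix.diagonal_one', Matrix.one_mulVec, run_nil]⟩
  · rintro ⟨i, j, hij, c⟩
    by_cases hc : c = 0
    · exact ⟨[], fun x => by simp [Matrix.TransvectionStruct.toMatrix, hc]⟩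
    · obtain rfl : c = 1 := Fin.eq_one_of_ne_zero c hc
      refine ⟨[.cnot j i hij.symm], fun x => ?_⟩
      ext l
      by_cases hl : l = i
      · subst hl
        simp [Gate.apply, Matrix.TransvectionStruct.toMatrix, Matrix.transvection,
          Matrix.add_mulVec, Matrix.single_mulVec]
      · simp [Gate.apply, Matrix.TransvectionStruct.toMatrix, Matrix.transvection,
          Matrix.add_mulVec, Matrix.single_mulVec, hl]
  · rintro A B - - ⟨C, hC⟩ ⟨D, hD⟩
    exact ⟨D ++ C, fun x => by rw [run_append, hD, hC, Matrix.mulVec_mulVec]⟩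

theorem exists_run_eq_linearEquiv (f : Bitstring n ≃ₗ[ZMod 2] Bitstring n) :
    ∃ C : Circuit n, ∀ x, run C x = f x := by
  obtain ⟨C, hC⟩ := exists_run_eq_mulVec (LinearMap.toMatrix' (f : Bitstring n →ₗ[ZMod 2] _))
    (by rw [LinearMap.det_toMatrix']; exact f.isUnit_det'.ne_zero)
  exact ⟨C, fun x => by rw [hC, LinearMap.toMatrix'_mulVec]; rfl⟩

/-- Over `ZMod 2` a projective point is a single nonzero vector, so 2-transitivity of linear maps on
projective points transfers. -/
instance isPreprimitive_nonzeroPermSubgroup :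
    IsPreprimitive (nonzeroPermSubgroup n) {x : Bitstring n // x ≠ 0} := by
  have mk_inj {x y : Bitstring n} {hx : x ≠ 0} {hy : y ≠ 0} :
      Projectivization.mk (ZMod 2) x hx = Projectivization.mk (ZMod 2) y hy ↔ x = y := by
    rw [Projectivization.mk_eq_mk_iff]
    refine ⟨fun ⟨a, ha⟩ => ?_, fun h => ⟨1, by simpa using h.symm⟩⟩
    rw [Subsingleton.elim a 1, one_smul] at ha
    exact ha.symm
  have mk_ne {x y : {x : Bitstring n // x ≠ 0}} (h : x ≠ y) :
      Projectivization.mk (ZMod 2) x.1 x.2 ≠ Projectivization.mk (ZMod 2) y.1 y.2 :=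
    fun h' => h (Subtype.ext (mk_inj.1 h'))
  refine isPreprimitive_of_is_two_pretransitive (is_two_pretransitive_iff.2 ?_)
  intro a b c d hab hcd
  obtain ⟨f, hac, hbd⟩ := is_two_pretransitive_iff.1
    (Projectivization.linearEquiv_is_two_pretransitive (ZMod 2) (Bitstring n))
    (mk_ne hab) (mk_ne hcd)
  rw [Projectivization.smul_mk, mk_inj] at hac hbd
  obtain ⟨τ, hτ, hf⟩ := exists_ofSubtype_eq (σ := f.toEquiv) (exists_run_eq_linearEquiv f)
  refine ⟨⟨τ, hτ⟩, Subtype.ext ?_, Subtype.ext ?_⟩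
  · rw [← hac, Subgroup.mk_smul, Perm.smul_def, ← ofSubtype_apply_coe, hf]
    rfl
  · rw [← hbd, Subgroup.mk_smul, Perm.smul_def, ← ofSubtype_apply_coe, hf]
    rfl

end Circuit

/-! ### Multiply controlled NOT gates -/

/-- Flip the bit `t` exactly when all the bits in `A` are `1`. -/
def controlledNot {n : ℕ} (A : Finset (Fin n)) (t : Fin n) (x : Bitstring n) : Bitstring n :=
  Function.update x t (x t + ∏ i ∈ A, x i)

section controlledNot

variable {n : ℕ} {A : Finset (Fin n)} {t : Fin n}

theorem prod_update_of_notMem (ht : t ∉ A) (x : Bitstring n) (a : ZMod 2) :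
    ∏ i ∈ A, Function.update x t a i = ∏ i ∈ A, x i :=
  Finset.prod_update_of_notMem ht _ _

theorem involutive_controlledNot (ht : t ∉ A) : Function.Involutive (controlledNot A t) := by
  intro x
  simp only [controlledNot, Function.update_self, Function.update_idem, prod_update_of_notMem ht]
  rw [add_assoc, CharTwo.add_self_eq_zero, add_zero, Function.update_eq_self]

theorem eq_one_of_controlledNot_ne {x : Bitstring n} (h : controlledNot A t x ≠ x) :
    ∀ i ∈ A, x i = 1 := by
  contrapose! h
  obtain ⟨i, hi, hx⟩ := h
  have hx0 : x i = 0 := by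
    by_contra h0
    exact hx (Fin.eq_one_of_ne_zero _ h0)
  rw [controlledNot, Finset.prod_eq_zero hi hx0, add_zero, Function.update_eq_self]

theorem controlledNot_one_ne : controlledNot A t (1 : Bitstring n) ≠ 1 := fun h => by
  simpa [controlledNot, CharTwo.add_self_eq_zero] using congrFun h t

/-- A spare wire `j` can be borrowed to add a control to a controlled gate. -/
theorem exists_run_eq_controlledNot (hA : A.Nonempty) (ht : t ∉ A) (hcard : A.card + 2 ≤ n) :
    ∃ C : Circuit n, ∀ x, C.run x = controlledNot A t x := by
  induction hA using Finset.Nonempty.cons_induction generalizing t with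
  | singleton c =>
    rw [Finset.mem_singleton] at ht
    exact ⟨[.cnot c t (Ne.symm ht)], fun x => by simp [Gate.apply, controlledNot]⟩
  | cons b A hb hA ih =>
    rw [Finset.mem_cons, not_or] at ht
    rw [Finset.card_cons] at hcard
    obtain ⟨j, hj⟩ : ∃ j, j ∉ insert t (insert b A) := by
      by_contra! h
      have h₁ := Finset.card_le_card (fun i _ => h i : Finset.univ ⊆ insert t (insert b A))
      have h₂ := Finset.card_insert_le t (insert b A)
      have h₃ := Finset.card_insert_le b A
      rw [Finset.card_univ, Fintype.card_fin] at h₁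
      omega
    simp only [Finset.mem_insert, not_or] at hj
    obtain ⟨hjt, hjb, hjA⟩ := hj
    obtain ⟨C, hC⟩ := ih hjA (by omega)
    let g : Gate n := .toffoli j b t hjb hjt (Ne.symm ht.1)
    -- With `p` the product over `A`, `C` adds `p` to wire `j`. The two uses of `g` add `(x j + p) *
    -- x b` and `x j * x b` to `t`, in total `p * x b`; the second `C` restores `j`.
    refine ⟨C ++ g :: (C ++ [g]), fun x => ?_⟩
    simp only [Circuit.run_append, Circuit.run_cons, Circuit.run_nil, hC]
    ext l
    have hg (y : Bitstring n) : g.apply y = Function.update y t (y t + y j * y b) := rfl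
    have hbt : b ≠ t := Ne.symm ht.1
    have hbj : b ≠ j := Ne.symm hjb
    simp only [hg, controlledNot, prod_update_of_notMem hjA, prod_update_of_notMem ht.2,
      Finset.prod_cons, Function.update_self, Function.update_of_ne hjt,
      Function.update_of_ne (Ne.symm hjt), Function.update_of_ne hbt, Function.update_of_ne hbj]
    set p := ∏ i ∈ A, x i
    have hp : p + p = 0 := CharTwo.add_self_eq_zero p
    have hxx : x j * x b + x j * x b = 0 := CharTwo.add_self_eq_zero _
    rcases eq_or_ne l t with rfl | hlt
    · simp only [Function.update_self]
      linear_combination hxx + hp * x b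
    · rcases eq_or_ne l j with rfl | hlj
      · simp only [Function.update_of_ne hlt, Function.update_self]
        linear_combination hp
      · simp only [Function.update_of_ne hlt, Function.update_of_ne hlj]

end controlledNot

/-- The commutator of two involutions whose supports meet in a single point is a three-cycle. -/
theorem isThreeCycle_of_involutive {α : Type*} [Fintype α] [DecidableEq α] {g h : Perm α} {p : α}
    (hg : Function.Involutive g) (hh : Function.Involutive h) (hgp : g p ≠ p) (hhp : h p ≠ p)
    (hp : ∀ x, g x ≠ x → h x ≠ x → x = p) : IsThreeCycle (g * h * g * h) := by
  have hgh : g p ≠ h p := by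
    intro e
    refine hgp (hp (g p) ?_ ?_)
    · rw [hg]; exact hgp.symm
    · rw [e, hh]; exact hhp.symm
  -- Away from `p` the two supports do not meet, so all other transpositions of `g` and `h` cancel.
  have key : g * h * g * h = swap p (h p) * swap p (g p) := by
    ext x
    simp only [Perm.mul_apply]
    have hg' : ∀ x, g (g x) = x := hg
    have hh' : ∀ x, h (h x) = x := hh
    have hhx : h x ≠ x → x ≠ h p → g (h x) = h x := fun h₁ h₂ => by
      by_contra h₃
      have := hp (h x) h₃ (by rwa [hh', ne_comm])
      exact h₂ (by rw [← this, hh'])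
    have hgx : g x ≠ x → x ≠ g p → h (g x) = g x := fun h₁ h₂ => by
      by_contra h₃
      have := hp (g x) (by rwa [hg', ne_comm]) h₃
      exact h₂ (by rw [← this, hg'])
    by_cases h₁ : h x = x <;> by_cases h₂ : g x = x <;> grind
  rw [key]
  exact isThreeCycle_swap_mul_swap_same hhp.symm hgp.symm hgh.symm

/-! ### The alternating group -/

namespace Circuit

variable {n : ℕ}

/-- Two NOTs with `n - 2` controls each, whose control sets cover all wires, both move only the
all-ones vector. -/
theorem exists_isThreeCycle (hn : 4 ≤ n) :
    ∃ σ ∈ nonzeroPermSubgroup n, IsThreeCycle σ := by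
  have mem (a b : Fin n) (hab : a ≠ b) : ∃ σ ∈ permSubgroup n, ∀ x,
      σ x = controlledNot {a, b}ᶜ a x := by
    have ha : a ∉ ({a, b} : Finset (Fin n))ᶜ := by simp
    have hcard : ({a, b} : Finset (Fin n))ᶜ.card + 2 = n := by
      rw [Finset.card_compl, Finset.card_pair hab, Fintype.card_fin]
      omega
    exact ⟨(involutive_controlledNot ha).toPerm, exists_run_eq_controlledNot
      (Finset.card_pos.1 (by omega)) ha hcard.le, fun _ => rfl⟩
  obtain ⟨g, hgmem, hg⟩ := mem ⟨0, by omega⟩ ⟨1, by omega⟩ (by simp)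
  obtain ⟨h, hhmem, hh⟩ := mem ⟨2, by omega⟩ ⟨3, by omega⟩ (by simp)
  obtain ⟨τ, hτ, he⟩ := exists_ofSubtype_eq
    (mul_mem (mul_mem (mul_mem hgmem hhmem) hgmem) hhmem)
  refine ⟨τ, hτ, ?_⟩
  rw [IsThreeCycle, ← cycleType_ofSubtype, he]
  refine isThreeCycle_of_involutive (p := 1) ?_ ?_ ?_ ?_ ?_
  · intro x
    rw [hg, hg, involutive_controlledNot (by simp)]
  · intro x
    rw [hh, hh, involutive_controlledNot (by simp)]
  · rw [hg]
    exact controlledNot_one_ne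
  · rw [hh]
    exact controlledNot_one_ne
  · intro x hx hx'
    rw [hg] at hx
    rw [hh] at hx'
    ext i
    by_cases hi : i ∈ ({⟨0, by omega⟩, ⟨1, by omega⟩} : Finset (Fin n))ᶜ
    · exact eq_one_of_controlledNot_ne hx i hi
    · refine eq_one_of_controlledNot_ne hx' i ?_
      simp only [Finset.mem_compl, Finset.mem_insert, Finset.mem_singleton, Fin.ext_iff] at hi ⊢
      omega

theorem exists_isSwap : ∃ σ ∈ nonzeroPermSubgroup 3, IsSwap σ := by
  let g : Gate 3 := .toffoli 0 1 2 (by decide) (by decide) (by decide)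
  obtain ⟨τ, hτ, he⟩ := exists_ofSubtype_eq (σ := g.involutive_apply.toPerm) ⟨[g], fun _ => rfl⟩
  -- On three wires a Toffoli gate only exchanges `110` and `111`.
  refine ⟨τ, hτ, ⟨![1, 1, 0], by decide⟩, ⟨1, by decide⟩, by decide, ?_⟩
  apply ofSubtype_injective
  rw [he, ofSubtype_swap_eq]
  ext1 x
  revert x
  decide

theorem alternatingGroup_le_nonzeroPermSubgroup (hn : 3 ≤ n) :
    alternatingGroup {x : Bitstring n // x ≠ 0} ≤ nonzeroPermSubgroup n := by
  obtain rfl | hn := hn.eq_or_lt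
  · obtain ⟨σ, hσ, hswap⟩ := exists_isSwap
    rw [subgroup_eq_top_of_isPreprimitive_of_isSwap_mem inferInstance σ hswap hσ]
    exact le_top
  · obtain ⟨σ, hσ, hcycle⟩ := exists_isThreeCycle hn
    exact alternatingGroup_le_of_isPreprimitive_of_isThreeCycle_mem inferInstance hcycle hσ

open scoped Pointwise in
/-- Circuits can move any set of nonzero bitstrings into any other set which is at least as
large. -/
theorem exists_run_mem (hn : 3 ≤ n) {s t : Finset (Bitstring n)} (hs : 0 ∈ s) (ht : 0 ∈ t)
    (hst : s.card ≤ t.card) : ∃ C : Circuit n, ∀ x ∈ s, run C x ∈ t := by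
  let α := {x : Bitstring n // x ≠ 0}
  have card_nonzero {u : Finset (Bitstring n)} (hu : 0 ∈ u) :
      (u.subtype (· ≠ 0)).card = u.card - 1 := by
    rw [Finset.card_subtype, Finset.filter_ne', Finset.card_erase_of_mem hu]
  obtain ⟨t', ht', hcard⟩ := Finset.exists_subset_card_eq
    (show (s.subtype (· ≠ 0)).card ≤ (t.subtype (· ≠ 0)).card by
      rw [card_nonzero hs, card_nonzero ht]; omega)
  have hα : 3 ≤ Nat.card α := by
    have h8 : 2 ^ 3 ≤ 2 ^ n := Nat.pow_le_pow_right two_pos hn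
    rw [Nat.card_eq_fintype_card, Fintype.card_subtype_compl, Fintype.card_subtype_eq,
      Fintype.card_fun, ZMod.card, Fintype.card_fin]
    omega
  have := Set.powersetCard.isPretransitive_alternatingGroup
    (n := (s.subtype (· ≠ 0)).card) hα
  obtain ⟨⟨σ, hσ⟩, h⟩ := exists_smul_eq (alternatingGroup α)
    (⟨s.subtype (· ≠ 0), rfl⟩ : Set.powersetCard α _) ⟨t', hcard⟩
  obtain ⟨C, hC⟩ := alternatingGroup_le_nonzeroPermSubgroup hn hσ
  refine ⟨C, fun x hx => ?_⟩
  rcases eq_or_ne x 0 with rfl | hx0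
  · rwa [run_zero]
  · rw [hC, show x = ((⟨x, hx0⟩ : α) : Bitstring n) from rfl, ofSubtype_apply_coe]
    refine Finset.mem_subtype.1 (ht' ?_)
    have h' := congrArg Subtype.val h
    change (⟨σ, hσ⟩ : alternatingGroup α) • s.subtype (· ≠ 0) = t' at h'
    rw [← h']
    exact Finset.smul_mem_smul_finset (a := (⟨σ, hσ⟩ : alternatingGroup α))
      (Finset.mem_subtype.2 hx)

end Circuit

/-! ### Counting and conclusion -/

theorem card_hammingNorm_le (n e : ℕ) :
    (Finset.univ.filter fun x : Bitstring n => hammingNorm x ≤ e).card ≤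
      ∑ i ∈ Finset.range (e + 1), n.choose i := by
  let supp (x : Bitstring n) : Finset (Fin n) := Finset.univ.filter fun i => x i ≠ 0
  have hinj : Function.Injective supp := by
    intro x y h
    ext i
    have hi : x i ≠ 0 ↔ y i ≠ 0 := by simpa [supp] using Finset.ext_iff.1 h i
    generalize x i = a at hi
    generalize y i = b at hi
    revert a b
    decide
  rw [← Finset.card_image_of_injective _ hinj]
  calc _ ≤ ((Finset.range (e + 1)).biUnion
        fun i => Finset.powersetCard i (Finset.univ : Finset (Fin n))).card := by
        refine Finset.card_le_card fun u hu => ?_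
        obtain ⟨x, hx, rfl⟩ := Finset.mem_image.1 hu
        exact Finset.mem_biUnion.2 ⟨_, Finset.mem_range.2 (Nat.lt_succ_of_le
          (Finset.mem_filter.1 hx).2), Finset.mem_powersetCard.2 ⟨Finset.subset_univ _, rfl⟩⟩
    _ ≤ _ := Finset.card_biUnion_le.trans (by simp [Finset.card_powersetCard])

theorem card_forall_mem_eq_zero (n : ℕ) (S : Finset (Fin n)) :
    (Finset.univ.filter fun x : Bitstring n => ∀ i ∈ S, x i = 0).card = 2 ^ (n - S.card) := by
  have h : (Finset.univ.filter fun x : Bitstring n => ∀ i ∈ S, x i = 0) =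
      Fintype.piFinset fun i => if i ∈ S then {0} else Finset.univ := by
    ext x
    simp only [Finset.mem_filter, Finset.mem_univ, true_and, Fintype.mem_piFinset]
    refine forall_congr' fun i => ?_
    by_cases hi : i ∈ S <;> simp [hi]
  rw [h, Fintype.card_piFinset]
  have hcard (i : Fin n) : (if i ∈ S then ({0} : Finset (ZMod 2)) else Finset.univ).card =
      if i ∈ S then 1 else 2 := by
    split_ifs <;> simp [ZMod.card]
  simp only [hcard]
  rw [Finset.prod_ite, Finset.prod_const_one, one_mul, Finset.prod_const,
    ← Finset.compl_filter, Finset.card_compl, Fintype.card_fin]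
  simp

theorem proposition1 (n k e : ℕ) (hn : 1 ≤ n) (hk : k ∈ Finset.Icc 1 n) (he : e ∈ Finset.Icc 1 n)
    (hbound : ∑ i ∈ Finset.range (e + 1), n.choose i ≤ 2 ^ (n - k)) :
    ∃ C : Circuit n, IsPurificationCircuit n k e C := by
  rw [Finset.mem_Icc] at hk he
  -- As `k, e ≥ 1`, the bound gives `1 + n ≤ 2 ^ (n - 1)`, which fails for `n = 1, 2`.
  have hn3 : 3 ≤ n := by
    have h₁ : ∑ i ∈ Finset.range 2, n.choose i ≤ ∑ i ∈ Finset.range (e + 1), n.choose i :=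
      Finset.sum_le_sum_of_subset (Finset.range_mono (by omega))
    have h₂ : 2 ^ (n - k) ≤ 2 ^ (n - 1) := Nat.pow_le_pow_right two_pos (by omega)
    have h₃ := h₁.trans (hbound.trans h₂)
    simp only [Finset.sum_range_succ, Finset.sum_range_zero, Nat.choose_zero_right,
      Nat.choose_one_right] at h₃
    by_contra! hlt
    interval_cases n <;> omega
  obtain ⟨S, -, hS⟩ := Finset.exists_subset_card_eq
    (show k ≤ (Finset.univ : Finset (Fin n)).card by simpa using hk.2)
  obtain ⟨C, hC⟩ := Circuit.exists_run_mem hn3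
    (s := Finset.univ.filter fun x => hammingNorm x ≤ e)
    (t := Finset.univ.filter fun x => ∀ i ∈ S, x i = 0) (by simp) (by simp)
    ((card_hammingNorm_le n e).trans
      (hbound.trans (by rw [card_forall_mem_eq_zero, hS])))
  exact ⟨C, S, hS, fun x hx => (Finset.mem_filter.1 (hC x (by simpa using hx))).2⟩
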